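/- Let $R$ be an associative ring with unity; modules are left $R$-modules. A module is Ding projective if it is isomorphic to a module of cycles of an exact complex $\cdots\to P_1\to P_0\to P_{-1}\to\cdots$ of projective modules that remains exact under $\mathrm{Hom}_R(-,F)$ for every flat module $F$. Let $\mathcal{DP}$ be the class of Ding projective modules, and let $\mathcal{DP}^{\perp}$ be the class of modules $X$ with $\mathrm{Ext}^1_R(D,X)=0$ for all $D\in\mathcal{DP}$. Assume that $\mathcal{DP}$ is covering, i.e. every module $M$ has a $\mathcal{DP}$-cover: a homomorphism $f:D\to M$ with $D\in\mathcal{DP}$ such that every homomorphism $D'\to M$ with $D'\in\mathcal{DP}$ factors through $f$, and every endomorphism $u$ of $D$ with $fu=f$ is an automorphism. Then: 1. every module in $\mathcal{DP}^{\perp}$ has a projective cover (a surjection from a projective module with superfluous kernel); 2. every flat module is projective; 3. $R$ is (left) perfect, i.e. every module has a projective cover. -/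

import Mathlib

open CategoryTheory
open scoped TensorProduct MulOpposite

universe u

/-! ### Tensor products and flat modules over a noncommutative ring

`R` is an associative unital ring, `R`-modules are left modules; a right `R`-module is a
`Module Rᵐᵒᵖ A`, the product `a r` being `MulOpposite.op r • a`. -/

/-- The subgroup of `A ⊗ M` (over `ℤ`) generated by the elements `a r ⊗ m - a ⊗ r m`. -/
def balancedRelations (R A M : Type u) [Ring R] [AddCommGroup A] [Module Rᵐᵒᵖ A]
    [AddCommGroup M] [Module R M] : AddSubgroup (A ⊗[ℤ] M) :=
  AddSubgroup.closure
    {x | ∃ (a : A) (r : R) (m : M), x = (MulOpposite.op r • a) ⊗ₜ[ℤ] m - a ⊗ₜ[ℤ] (r • m)}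

/-- The abelian group `A ⊗_R M` for a right `R`-module `A` and a left `R`-module `M`. -/
abbrev BalancedTensor (R A M : Type u) [Ring R] [AddCommGroup A] [Module Rᵐᵒᵖ A]
    [AddCommGroup M] [Module R M] : Type u :=
  (A ⊗[ℤ] M) ⧸ balancedRelations R A M

theorem balancedRelations_le_comap {R A B : Type u} (M : Type u) [Ring R]
    [AddCommGroup A] [Module Rᵐᵒᵖ A] [AddCommGroup B] [Module Rᵐᵒᵖ B]
    [AddCommGroup M] [Module R M] (f : A →ₗ[Rᵐᵒᵖ] B) :
    balancedRelations R A M ≤ (balancedRelations R B M).comap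
      (LinearMap.rTensor M f.toAddMonoidHom.toIntLinearMap).toAddMonoidHom := by
  rw [balancedRelations, AddSubgroup.closure_le]
  rintro _ ⟨a, r, m, rfl⟩
  refine AddSubgroup.subset_closure ⟨f a, r, m, ?_⟩
  simp

/-- The homomorphism `f ⊗_R M : A ⊗_R M → B ⊗_R M`, `a ⊗ m ↦ f a ⊗ m`. -/
def BalancedTensor.map {R A B : Type u} (M : Type u) [Ring R]
    [AddCommGroup A] [Module Rᵐᵒᵖ A] [AddCommGroup B] [Module Rᵐᵒᵖ B]
    [AddCommGroup M] [Module R M] (f : A →ₗ[Rᵐᵒᵖ] B) :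
    BalancedTensor R A M →+ BalancedTensor R B M :=
  QuotientAddGroup.map _ _
    (LinearMap.rTensor M f.toAddMonoidHom.toIntLinearMap).toAddMonoidHom
    (balancedRelations_le_comap M f)

/-- The left `R`-module `M` is flat: `- ⊗_R M` preserves injections of right `R`-modules. -/
def IsFlatModule (R M : Type u) [Ring R] [AddCommGroup M] [Module R M] : Prop :=
  ∀ (A B : Type u) [AddCommGroup A] [Module Rᵐᵒᵖ A] [AddCommGroup B] [Module Rᵐᵒᵖ B]
    (f : A →ₗ[Rᵐᵒᵖ] B), Function.Injective f → Function.Injective (BalancedTensor.map M f)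

/-! ### Ding projective modules -/

/-- `M` is Ding projective: it is isomorphic to a module of cycles of an exact complex
`⋯ → P (i + 1) → P i → P (i - 1) → ⋯` of projective modules (indexed by `ℤ`, with differentials
`d i : P (i + 1) → P i`) which stays exact under `Hom(-, F)` for every flat module `F`. -/
def IsDingProjective (R : Type u) [Ring R] : ObjectProperty (ModuleCat.{u} R) := fun M =>
  ∃ (P : ℤ → ModuleCat.{u} R) (d : ∀ i : ℤ, P (i + 1) →ₗ[R] P i),
    (∀ i, Module.Projective R (P i)) ∧
    (∀ i, Function.Exact (d (i + 1)) (d i)) ∧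
    (∀ F : ModuleCat.{u} R, IsFlatModule R F → ∀ i,
      Function.Exact (fun g : P i →ₗ[R] F => g ∘ₗ d i)
        (fun g : P (i + 1) →ₗ[R] F => g ∘ₗ d (i + 1))) ∧
    ∃ i, Nonempty (M ≃ₗ[R] LinearMap.ker (d i))

/-! ### Orthogonal classes, covers, perfect rings -/

/-- The right orthogonal class `𝒞^⊥`: the modules `X` with `Ext¹(C, X) = 0` for all `C ∈ 𝒞`. -/
def extRightOrthogonal {R : Type u} [Ring R] (𝒞 : ObjectProperty (ModuleCat.{u} R)) :
    ObjectProperty (ModuleCat.{u} R) := fun X =>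
  ∀ C : ModuleCat.{u} R, 𝒞 C → Subsingleton (Abelian.Ext.{u} C X 1)

/-- `f : C ⟶ M` is a `𝒞`-cover of `M`: `C ∈ 𝒞`, every morphism from an object of `𝒞` to `M` factors
through `f`, and every endomorphism `u` of `C` with `f u = f` is an automorphism. -/
structure IsClassCover {R : Type u} [Ring R] (𝒞 : ObjectProperty (ModuleCat.{u} R))
    {C M : ModuleCat.{u} R} (f : C ⟶ M) : Prop where
  mem : 𝒞 C
  factors : ∀ (C' : ModuleCat.{u} R), 𝒞 C' → ∀ g : C' ⟶ M, ∃ h : C' ⟶ C, h ≫ f = g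
  isIso : ∀ u : C ⟶ C, u ≫ f = f → IsIso u

/-- The class `𝒞` is covering: every module has a `𝒞`-cover. -/
def IsCoveringClass {R : Type u} [Ring R] (𝒞 : ObjectProperty (ModuleCat.{u} R)) : Prop :=
  ∀ M : ModuleCat.{u} R, ∃ (C : ModuleCat.{u} R) (f : C ⟶ M), IsClassCover 𝒞 f

/-- `M` has a projective cover: a surjection `P → M` with `P` projective and superfluous kernel. -/
def HasProjectiveCover (R M : Type u) [Ring R] [AddCommGroup M] [Module R M] : Prop :=
  ∃ (P : ModuleCat.{u} R) (f : P →ₗ[R] M), Module.Projective R P ∧ Function.Surjective f ∧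
    ∀ N : Submodule R P, N ⊔ LinearMap.ker f = ⊤ → N = ⊤

/-- `R` is (left) perfect: every (left) `R`-module has a projective cover. -/
def IsLeftPerfectRing (R : Type u) [Ring R] : Prop :=
  ∀ M : ModuleCat.{u} R, HasProjectiveCover R M

/-! A Ding projective module `D` is a module of cycles, so it embeds in a projective `P` of its
complex. If `M` is flat, every map `D → M` extends to `P` because the complex stays exact under
`Hom(-, M)`. If `M ∈ 𝒟𝒫^⊥`, it extends because `P / D` is again Ding projective. Now let `f : D → M`
be a cover; it is onto, since `R` is Ding projective. Extend `f` to `P` and lift the extension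
through `f`: this gives an endomorphism `u` of `D` factoring through `P` with `f u = f`. So `u` is
an automorphism, `D` is a summand of `P`, and the cover is a projective cover
(`IsClassCover.hasProjectiveCover`). A flat module with a projective cover is projective, by
Villamayor's criterion. Hence flat modules are projective, and Bass's argument gives perfectness: a
direct limit of copies of `R` yields a chain condition on principal right ideals, this yields a
T-nilpotency statement, and Zorn's lemma then produces projective covers. -/

/-! ### Balanced tensor products and directed unions -/

namespace BalancedTensor

variable {R A B M N : Type u} [Ring R] [AddCommGroup A] [Module Rᵐᵒᵖ A]
  [AddCommGroup B] [Module Rᵐᵒᵖ B] [AddCommGroup M] [Module R M] [AddCommGroup N] [Module R N]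
  {G : Type*} [AddCommGroup G]

/-- The universal biadditive balanced map `a, m ↦ a ⊗ m`. -/
def mk (R A M : Type u) [Ring R] [AddCommGroup A] [Module Rᵐᵒᵖ A]
    [AddCommGroup M] [Module R M] : A →+ M →+ BalancedTensor R A M :=
  AddMonoidHom.mk' (fun a => AddMonoidHom.mk'
      (fun m => QuotientAddGroup.mk' (balancedRelations R A M) (a ⊗ₜ[ℤ] m))
      (fun m m' => by rw [TensorProduct.tmul_add, map_add]))
    (fun a a' => by ext m; simp only [AddMonoidHom.mk'_apply, AddMonoidHom.add_apply,
      TensorProduct.add_tmul, map_add])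

theorem mk_apply (a : A) (m : M) :
    mk R A M a m = QuotientAddGroup.mk' (balancedRelations R A M) (a ⊗ₜ[ℤ] m) := rfl

theorem mk_smul (a : A) (r : R) (m : M) :
    mk R A M (MulOpposite.op r • a) m = mk R A M a (r • m) := by
  rw [mk_apply, mk_apply, ← sub_eq_zero, ← map_sub, QuotientAddGroup.mk'_apply,
    QuotientAddGroup.eq_zero_iff]
  exact AddSubgroup.subset_closure ⟨a, r, m, rfl⟩

@[elab_as_elim]
theorem induction {p : BalancedTensor R A M → Prop} (z : BalancedTensor R A M)
    (zero : p 0) (tmul : ∀ a m, p (mk R A M a m)) (add : ∀ x y, p x → p y → p (x + y)) : p z := by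
  obtain ⟨w, rfl⟩ := QuotientAddGroup.mk'_surjective _ z
  induction w using TensorProduct.induction_on with
  | zero => simpa using zero
  | tmul a m => exact tmul a m
  | add x y hx hy => rw [map_add]; exact add _ _ hx hy

@[simp]
theorem map_mk (f : A →ₗ[Rᵐᵒᵖ] B) (a : A) (m : M) :
    map M f (mk R A M a m) = mk R B M (f a) m := by
  simp [map, mk_apply]

/-- The homomorphism out of `A ⊗_R M` induced by a biadditive balanced map. -/
def lift (φ : A →+ M →+ G) (h : ∀ a (r : R) m, φ (MulOpposite.op r • a) m = φ a (r • m)) :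
    BalancedTensor R A M →+ G :=
  QuotientAddGroup.lift (balancedRelations R A M)
    (TensorProduct.liftAddHom φ (fun r a m => by simp)) (by
      rw [balancedRelations, AddSubgroup.closure_le]
      rintro _ ⟨a, r, m, rfl⟩
      simp [h])

@[simp]
theorem lift_mk (φ : A →+ M →+ G)
    (h : ∀ a (r : R) m, φ (MulOpposite.op r • a) m = φ a (r • m)) (a : A) (m : M) :
    lift φ h (mk R A M a m) = φ a m := by
  simp [lift, mk_apply]

/-- The homomorphism `A ⊗_R g : A ⊗_R M → A ⊗_R N`. -/
def mapRight (A : Type u) [AddCommGroup A] [Module Rᵐᵒᵖ A] (g : M →ₗ[R] N) :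
    BalancedTensor R A M →+ BalancedTensor R A N :=
  lift ((mk R A N).compl₂ g.toAddMonoidHom) (fun a r m => by simp [mk_smul])

@[simp]
theorem mapRight_mk (g : M →ₗ[R] N) (a : A) (m : M) :
    mapRight A g (mk R A M a m) = mk R A N a (g m) := by
  simp [mapRight]

theorem mapRight_surjective (g : M →ₗ[R] N) (hg : Function.Surjective g) :
    Function.Surjective (mapRight A g) := by
  intro z
  induction z using induction with
  | zero => exact ⟨0, map_zero _⟩
  | tmul a n =>
    obtain ⟨m, rfl⟩ := hg n
    exact ⟨mk R A M a m, mapRight_mk g a m⟩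
  | add x y hx hy =>
    obtain ⟨x', rfl⟩ := hx
    obtain ⟨y', rfl⟩ := hy
    exact ⟨x' + y', map_add _ _ _⟩

theorem map_mapRight (f : A →ₗ[Rᵐᵒᵖ] B) (g : M →ₗ[R] N) (z : BalancedTensor R A M) :
    map N f (mapRight A g z) = mapRight B g (map M f z) := by
  induction z using induction with
  | zero => simp
  | tmul a m => simp
  | add x y hx hy => simp only [map_add, hx, hy]

/-- The homomorphism `A ⊗_R M → A`, `a ⊗ m ↦ a f(m)` given by a linear form `f` on `M`. -/
def contract (A : Type u) [AddCommGroup A] [Module Rᵐᵒᵖ A] (f : M →ₗ[R] R) :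
    BalancedTensor R A M →+ A :=
  lift (AddMonoidHom.mk' (fun a => AddMonoidHom.mk' (fun m => MulOpposite.op (f m) • a)
      (fun m m' => by simp [add_smul]))
    (fun a a' => by ext m; simp)) (fun a r m => by simp [mul_smul])

@[simp]
theorem contract_mk (f : M →ₗ[R] R) (a : A) (m : M) :
    contract A f (mk R A M a m) = MulOpposite.op (f m) • a := by
  simp [contract]

theorem contract_map (f : M →ₗ[R] R) (g : A →ₗ[Rᵐᵒᵖ] B) (z : BalancedTensor R A M) :
    contract B f (map M g z) = g (contract A f z) := by
  induction z using induction with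
  | zero => simp
  | tmul a m => simp
  | add x y hx hy => simp only [map_add, hx, hy]

/-- An element of `B ⊗_R M` that vanishes modulo a directed union of submodules vanishes modulo
one of them. -/
theorem exists_mapRight_mkQ_eq_zero {ι : Type*} [Nonempty ι] (U : ι → Submodule R M)
    (hU : Directed (· ≤ ·) U) (w : BalancedTensor R B M)
    (hw : mapRight B (⨆ i, U i).mkQ w = 0) : ∃ i, mapRight B (U i).mkQ w = 0 := by
  have mono : ∀ {V W : Submodule R M}, V ≤ W → ∀ x : BalancedTensor R B M,
      mapRight B V.mkQ x = 0 → mapRight B W.mkQ x = 0 := by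
    intro V W hVW x hx
    have key : ∀ x : BalancedTensor R B M,
        mapRight B W.mkQ x = mapRight B (Submodule.factor hVW) (mapRight B V.mkQ x) := by
      intro x
      induction x using induction with
      | zero => simp
      | tmul a m => simp
      | add x y hx hy => simp only [map_add, hx, hy]
    rw [key, hx, map_zero]
  -- `K` collects what dies at some stage. Since `b ⊗ m ∈ K` for `m` in the union, the projection
  -- modulo `K` factors through `B ⊗ (M ⧸ ⨆ U)`, so everything that dies there lies in `K`.
  let K : AddSubgroup (BalancedTensor R B M) :=
    { carrier := {x | ∃ i, mapRight B (U i).mkQ x = 0}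
      zero_mem' := ⟨Classical.arbitrary ι, map_zero _⟩
      add_mem' := by
        rintro x y ⟨i, hi⟩ ⟨j, hj⟩
        obtain ⟨k, hik, hjk⟩ := hU i j
        exact ⟨k, by rw [map_add, mono hik x hi, mono hjk y hj, add_zero]⟩
      neg_mem' := by
        rintro x ⟨i, hi⟩
        exact ⟨i, by rw [map_neg, hi, neg_zero]⟩ }
  let Φ : B →+ (M ⧸ (⨆ i, U i)) →+ BalancedTensor R B M ⧸ K :=
    AddMonoidHom.mk' (fun b => QuotientAddGroup.lift (⨆ i, U i).toAddSubgroup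
        ((QuotientAddGroup.mk' K).comp (mk R B M b)) (by
          intro m hm
          obtain ⟨i, hi⟩ := (Submodule.mem_iSup_of_directed U hU).1 hm
          refine (QuotientAddGroup.eq_zero_iff _).2 ⟨i, ?_⟩
          rw [mapRight_mk, Submodule.mkQ_apply, (Submodule.Quotient.mk_eq_zero _).2 hi, map_zero]))
      (fun b b' => by
        ext m
        obtain ⟨m, rfl⟩ := Submodule.mkQ_surjective _ m
        change QuotientAddGroup.mk' K (mk R B M (b + b') m) =
          QuotientAddGroup.mk' K (mk R B M b m) + QuotientAddGroup.mk' K (mk R B M b' m)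
        rw [map_add, AddMonoidHom.add_apply, map_add])
  have hΦ : ∀ b m, Φ b ((⨆ i, U i).mkQ m) = QuotientAddGroup.mk' K (mk R B M b m) :=
    fun b m => rfl
  let Ψ : BalancedTensor R B (M ⧸ (⨆ i, U i)) →+ BalancedTensor R B M ⧸ K :=
    lift Φ (by
      intro b r m
      obtain ⟨m, rfl⟩ := Submodule.mkQ_surjective _ m
      rw [← map_smul, hΦ, hΦ, mk_smul])
  have hΨ : ∀ x, Ψ (mapRight B (⨆ i, U i).mkQ x) = QuotientAddGroup.mk' K x := by
    intro x
    induction x using induction with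
    | zero => simp
    | tmul b m => rw [mapRight_mk, lift_mk, hΦ]
    | add x y hx hy => simp only [map_add, hx, hy]
  have h0 := hΨ w
  rw [hw, map_zero] at h0
  exact (QuotientAddGroup.eq_zero_iff w).1 h0.symm

end BalancedTensor

/-! ### Flat modules and Villamayor's criterion -/

section Flat

variable {R : Type u} [Ring R]

-- A dual basis writes each tensor as a finite sum `∑ fₓ(z) ⊗ x`, where the contractions `fₓ(z)`
-- commute with maps in the first variable. An injective map therefore detects every coefficient.
open BalancedTensor in
theorem isFlatModule_of_projective (P : Type u) [AddCommGroup P] [Module R P]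
    [Module.Projective R P] : IsFlatModule R P := by
  obtain ⟨s, hs⟩ := Module.projective_def.1 (inferInstance : Module.Projective R P)
  intro A B _ _ _ _ g hg
  have key : ∀ z : BalancedTensor R A P, ∃ T : Finset P, ∀ T', T ⊆ T' →
      z = ∑ x ∈ T', BalancedTensor.mk R A P (contract A (Finsupp.lapply x ∘ₗ s) z) x := by
    classical
    intro z
    induction z using BalancedTensor.induction with
    | zero => exact ⟨∅, fun T' _ => by simp⟩
    | tmul a m =>
      refine ⟨(s m).support, fun T' hT' => ?_⟩
      simp only [contract_mk, mk_smul, ← map_sum]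
      congr 1
      conv_lhs => rw [← hs m, Finsupp.linearCombination_apply, Finsupp.sum_of_support_subset _ hT'
        _ (by simp)]
      rfl
    | add x y hx hy =>
      obtain ⟨S, hS⟩ := hx
      obtain ⟨T, hT⟩ := hy
      refine ⟨S ∪ T, fun T' h => ?_⟩
      conv_lhs => rw [hS T' (Finset.subset_union_left.trans h),
        hT T' (Finset.subset_union_right.trans h)]
      simp [Finset.sum_add_distrib]
  rw [injective_iff_map_eq_zero]
  intro z hz
  obtain ⟨T, hT⟩ := key z
  rw [hT T subset_rfl]
  refine Finset.sum_eq_zero fun x _ => ?_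
  have : contract A (Finsupp.lapply x ∘ₗ s) z = 0 := by
    apply hg
    rw [← contract_map, hz, map_zero, map_zero]
  rw [this, map_zero, AddMonoidHom.zero_apply]

/-- A quotient by a directed union is flat if the quotients by the members are flat. -/
theorem isFlatModule_quotient_iSup {P : Type u} [AddCommGroup P] [Module R P] {ι : Type*}
    [Nonempty ι] (U : ι → Submodule R P) (hU : Directed (· ≤ ·) U)
    (hflat : ∀ i, IsFlatModule R (P ⧸ U i)) : IsFlatModule R (P ⧸ ⨆ i, U i) := by
  intro A B _ _ _ _ g hg
  rw [injective_iff_map_eq_zero]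
  intro z hz
  obtain ⟨w, rfl⟩ := BalancedTensor.mapRight_surjective _ (Submodule.mkQ_surjective _) z
  rw [BalancedTensor.map_mapRight] at hz
  obtain ⟨i, hi⟩ := BalancedTensor.exists_mapRight_mkQ_eq_zero U hU _ hz
  rw [← BalancedTensor.map_mapRight] at hi
  have hwi := (injective_iff_map_eq_zero _).1 (hflat i A B g hg) _ hi
  have key : ∀ x : BalancedTensor R A P, BalancedTensor.mapRight A (⨆ i, U i).mkQ x =
      BalancedTensor.mapRight A (Submodule.factor (le_iSup U i))
        (BalancedTensor.mapRight A (U i).mkQ x) := by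
    intro x
    induction x using BalancedTensor.induction with
    | zero => simp
    | tmul a m => simp
    | add x y hx hy => simp only [map_add, hx, hy]
  rw [key, hwi, map_zero]

/-- The equational criterion: a relation `∑ cᵢ mᵢ = 0` in a flat module lies in the subgroup
generated by the relations `aᵢ y` with `∑ cᵢ aᵢ = 0`. -/
theorem IsFlatModule.mem_closure_of_sum_smul_eq_zero {F : Type u} [AddCommGroup F] [Module R F]
    (hF : IsFlatModule R F) {ι : Type u} [Fintype ι] (c : ι → R) (m : ι → F)
    (h : ∑ i, c i • m i = 0) :
    m ∈ AddSubgroup.closure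
      {v : ι → F | ∃ (a : ι → R) (y : F), ∑ i, c i * a i = 0 ∧ v = fun i => a i • y} := by
  classical
  set L := AddSubgroup.closure
      {v : ι → F | ∃ (a : ι → R) (y : F), ∑ i, c i * a i = 0 ∧ v = fun i => a i • y}
  let γ : (ι → R) →ₗ[Rᵐᵒᵖ] R :=
    { toFun := fun a => ∑ i, c i * a i
      map_add' := fun a b => by simp [mul_add, Finset.sum_add_distrib]
      map_smul' := fun r a => by simp [Finset.sum_mul, mul_assoc] }
  have hγ : ∀ a, γ a = ∑ i, c i * a i := fun _ => rfl
  -- Flatness is used for the right ideal `I = ∑ cᵢ R` in `R`. The set-theoretic section `σ` of `γ`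
  -- becomes linear modulo `L`, because `L` absorbs the kernel of `γ`; so `a ↦ (aᵢ y)` descends to
  -- `I ⊗ F → F^ι / L`, which sends `∑ cᵢ ⊗ mᵢ` to the class of `m`.
  let I := LinearMap.range γ
  have hc : ∀ i, c i ∈ I := fun i => ⟨Pi.single i 1, by simp [hγ, Pi.single_apply]⟩
  choose σ hσ using fun b : I => b.2
  have hL : ∀ (a a' : ι → R) (y : F), γ a = γ a' →
      (QuotientAddGroup.mk' L fun i => a i • y) = QuotientAddGroup.mk' L fun i => a' i • y := by
    intro a a' y haa'
    rw [← sub_eq_zero, ← map_sub]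
    refine (QuotientAddGroup.eq_zero_iff _).2 (AddSubgroup.subset_closure ⟨a - a', y, ?_, ?_⟩)
    · rw [← hγ, map_sub, haa', sub_self]
    · ext i
      simp [sub_smul]
  let Φ : I →+ F →+ (ι → F) ⧸ L :=
    AddMonoidHom.mk' (fun b => AddMonoidHom.mk' (fun y => QuotientAddGroup.mk' L fun i => σ b i • y)
        (fun y y' => by rw [← map_add]; congr 1; ext i; simp))
      (fun b b' => by
        ext y
        simp only [AddMonoidHom.mk'_apply, AddMonoidHom.add_apply]
        rw [← map_add, hL (σ (b + b')) (σ b + σ b') y (by rw [map_add, hσ, hσ, hσ]; rfl)]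
        congr 1; ext i; simp [add_smul])
  let Ψ : BalancedTensor R I F →+ (ι → F) ⧸ L :=
    BalancedTensor.lift Φ (by
      intro b r y
      simp only [Φ, AddMonoidHom.mk'_apply]
      rw [hL (σ (MulOpposite.op r • b)) (MulOpposite.op r • σ b) y
        (by rw [map_smul, hσ, hσ]; rfl)]
      congr 1; ext i; simp [mul_smul])
  let z : BalancedTensor R I F := ∑ i, BalancedTensor.mk R I F ⟨c i, hc i⟩ (m i)
  have hz : z = 0 := by
    apply hF I R I.subtype I.injective_subtype
    have : ∀ i, BalancedTensor.mk R R F (c i) (m i) = BalancedTensor.mk R R F 1 (c i • m i) := by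
      intro i
      rw [← BalancedTensor.mk_smul]
      simp
    simp only [z, map_sum, map_zero, BalancedTensor.map_mk, Submodule.subtype_apply, this]
    rw [← map_sum, h, map_zero]
  have hΨ : Ψ z = QuotientAddGroup.mk' L m := by
    have : ∀ i, Ψ (BalancedTensor.mk R I F ⟨c i, hc i⟩ (m i)) =
        QuotientAddGroup.mk' L (Pi.single i (m i)) := by
      intro i
      rw [BalancedTensor.lift_mk]
      simp only [Φ, AddMonoidHom.mk'_apply]
      rw [hL _ (Pi.single i 1) (m i) (by rw [hσ]; simp [hγ, Pi.single_apply])]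
      congr 1; ext j
      by_cases hj : j = i
      · subst hj; simp
      · simp [hj]
    rw [map_sum, Finset.sum_congr rfl fun i _ => this i, ← map_sum, Finset.univ_sum_single]
  rw [hz, map_zero] at hΨ
  exact (QuotientAddGroup.eq_zero_iff m).1 hΨ.symm

/-- Villamayor's criterion for free modules: every element of the kernel of a map onto a flat
module is fixed by an endomorphism with values in the kernel. -/
theorem IsFlatModule.exists_endomorphism_fixing_finsupp {F X : Type u} [AddCommGroup F]
    [Module R F] (hF : IsFlatModule R F) (π : (X →₀ R) →ₗ[R] F) (hπ : Function.Surjective π)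
    (k : X →₀ R) (hk : π k = 0) :
    ∃ θ : (X →₀ R) →ₗ[R] (X →₀ R), π ∘ₗ θ = 0 ∧ θ k = k := by
  classical
  have hsum : ∀ (f : X → (X →₀ R)), ∑ i : k.support, k i • f i =
      Finsupp.linearCombination R f k := fun f => by
    rw [Finsupp.linearCombination_apply, Finsupp.sum, ← Finset.sum_coe_sort k.support]
  have hk1 : ∑ i : k.support, k i • Finsupp.single (i : X) (1 : R) = k := by
    rw [hsum fun i => Finsupp.single i 1, Finsupp.linearCombination_apply]
    simp
  have hrel : ∑ i : k.support, k i • π (Finsupp.single (i : X) 1) = 0 := by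
    simp only [← map_smul, ← map_sum]
    rw [hk1, hk]
  have hmem := hF.mem_closure_of_sum_smul_eq_zero (fun i : k.support => k i)
    (fun i => π (Finsupp.single (i : X) 1)) hrel
  obtain ⟨w, hw, hw0⟩ : ∃ w : k.support → (X →₀ R),
      (∀ i, π (w i) = π (Finsupp.single (i : X) 1)) ∧ ∑ i : k.support, k i • w i = 0 := by
    refine AddSubgroup.closure_induction (p := fun v _ => ∃ w : k.support → (X →₀ R),
      (∀ i, π (w i) = v i) ∧ ∑ i : k.support, k i • w i = 0) ?_ ?_ ?_ ?_ hmem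
    · rintro _ ⟨a, y, ha, rfl⟩
      obtain ⟨p, rfl⟩ := hπ y
      refine ⟨fun i => a i • p, fun i => map_smul _ _ _, ?_⟩
      simp only [← mul_smul, ← Finset.sum_smul]
      rw [ha, zero_smul]
    · exact ⟨0, by simp, by simp⟩
    · rintro v v' _ _ ⟨w, h1, h2⟩ ⟨w', h1', h2'⟩
      exact ⟨w + w', fun i => by simp [h1, h1'], by simp only [Pi.add_apply, smul_add, Finset.sum_add_distrib, h2, h2', add_zero]⟩
    · rintro v _ ⟨w, h1, h2⟩
      exact ⟨-w, fun i => by simp [h1],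
        by simp only [Pi.neg_apply, smul_neg, Finset.sum_neg_distrib, h2, neg_zero]⟩
  -- The `w i` lift the images of the basis vectors and satisfy `∑ kᵢ wᵢ = 0`. Subtracting them
  -- moves the basis vectors into the kernel without changing the combination `k`.
  let f : X → (X →₀ R) := fun x => if hx : x ∈ k.support then Finsupp.single x 1 - w ⟨x, hx⟩ else 0
  have hf : ∀ x, π (f x) = 0 := by
    intro x
    by_cases hx : x ∈ k.support
    · simp only [f, dif_pos hx, map_sub, hw ⟨x, hx⟩, sub_self]
    · simp only [f, dif_neg hx, map_zero]
  refine ⟨Finsupp.linearCombination R f, ?_, ?_⟩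
  · ext x
    simp [hf x]
  · rw [← hsum f]
    have : ∀ i : k.support, k i • f i = k i • Finsupp.single (i : X) (1 : R) - k i • w i := by
      intro i
      simp only [f, dif_pos i.2, smul_sub]
    rw [Finset.sum_congr rfl fun i _ => this i, Finset.sum_sub_distrib, hw0, sub_zero, hk1]

/-- Villamayor's criterion for projective modules. -/
theorem IsFlatModule.exists_endomorphism_fixing {F P : Type u} [AddCommGroup F]
    [Module R F] (hF : IsFlatModule R F) [AddCommGroup P] [Module R P] [Module.Projective R P]
    (π : P →ₗ[R] F) (hπ : Function.Surjective π) (k : P) (hk : π k = 0) :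
    ∃ θ : P →ₗ[R] P, π ∘ₗ θ = 0 ∧ θ k = k := by
  obtain ⟨s, hs⟩ := Module.projective_def.1 (inferInstance : Module.Projective R P)
  have hsurj : Function.Surjective (Finsupp.linearCombination R (id : P → P)) := hs.surjective
  obtain ⟨θ, hθ, hθk⟩ := hF.exists_endomorphism_fixing_finsupp
    (π ∘ₗ Finsupp.linearCombination R id) (hπ.comp hsurj) (s k) (by
      rw [LinearMap.comp_apply, hs k, hk])
  refine ⟨Finsupp.linearCombination R id ∘ₗ θ ∘ₗ s, ?_, ?_⟩
  · rw [← LinearMap.comp_assoc, ← LinearMap.comp_assoc, hθ, LinearMap.zero_comp]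
  · rw [LinearMap.comp_apply, LinearMap.comp_apply, hθk, hs k]

/-- A flat module with a projective cover is projective. -/
theorem IsFlatModule.projective_of_hasProjectiveCover {F : Type u} [AddCommGroup F]
    [Module R F] (hF : IsFlatModule R F) (h : HasProjectiveCover R F) : Module.Projective R F := by
  obtain ⟨P, π, hP, hπ, hsf⟩ := h
  have hinj : Function.Injective π := by
    rw [injective_iff_map_eq_zero]
    intro k hk
    obtain ⟨θ, hθ, hθk⟩ := hF.exists_endomorphism_fixing π hπ k hk
    have hθ' : ∀ p, θ p ∈ LinearMap.ker π := fun p => LinearMap.congr_fun hθ p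
    -- Superfluity is used twice: it makes `ψ` onto, then makes a section `t` of `ψ` onto. So `ψ` is
    -- injective, while it kills `k`.
    let ψ : P →ₗ[R] P := LinearMap.id - θ
    have hψ : ∀ p, ψ p = p - θ p := fun _ => rfl
    have hrange : LinearMap.range ψ = ⊤ := by
      refine hsf _ (eq_top_iff.2 fun p _ => ?_)
      have : p = ψ p + θ p := by rw [hψ, sub_add_cancel]
      rw [this]
      exact Submodule.add_mem_sup ⟨p, rfl⟩ (hθ' p)
    obtain ⟨t, ht⟩ := LinearMap.exists_rightInverse_of_surjective _ hrange
    have htop : LinearMap.range t = ⊤ := by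
      refine hsf _ (eq_top_iff.2 fun p _ => ?_)
      have h1 : ψ (p - t (ψ p)) = 0 := by
        rw [map_sub, ← LinearMap.comp_apply, ht, LinearMap.id_apply, sub_self]
      rw [hψ, sub_eq_zero] at h1
      rw [← add_sub_cancel (t (ψ p)) p]
      refine Submodule.add_mem_sup ⟨_, rfl⟩ ?_
      rw [h1]
      exact hθ' _
    obtain ⟨p, rfl⟩ := LinearMap.range_eq_top.1 htop k
    have : ψ (t p) = 0 := by
      rw [hψ, hθk, sub_self]
    rw [← LinearMap.comp_apply, ht, LinearMap.id_apply] at this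
    rw [this, map_zero]
  exact Module.Projective.of_equiv' (LinearEquiv.ofBijective π ⟨hinj, hπ⟩)

end Flat

/-! ### Bass: if flat modules are projective, the ring is perfect -/

section Perfect

variable {R : Type u} [Ring R]

theorem projective_quotient_ker_of_idempotent {P : Type u} [AddCommGroup P] [Module R P]
    [Module.Projective R P] (ψ : P →ₗ[R] P) (hψ : ∀ p, ψ (ψ p) = ψ p) :
    Module.Projective R (P ⧸ LinearMap.ker ψ) := by
  refine Module.Projective.of_split ((LinearMap.ker ψ).liftQ ψ le_rfl) (LinearMap.ker ψ).mkQ ?_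
  ext p
  simp only [LinearMap.comp_apply, Submodule.liftQ_apply, Submodule.mkQ_apply, LinearMap.id_apply]
  rw [Submodule.Quotient.eq, LinearMap.mem_ker, map_sub, hψ, sub_self]

/-- The shift `xₙ ↦ a xₙ₊₁`, `xᵢ ↦ xᵢ` for `i ≠ n`, of the free module on `x₀, x₁, …`. -/
noncomputable def basisShift (a : R) (n : ℕ) : (ℕ →₀ R) →ₗ[R] (ℕ →₀ R) :=
  Finsupp.linearCombination R
    fun i => if i = n then Finsupp.single (n + 1) a else Finsupp.single i 1

theorem basisShift_self (a c : R) (n : ℕ) :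
    basisShift a n (Finsupp.single n c) = Finsupp.single (n + 1) (c * a) := by
  simp [basisShift]

theorem basisShift_of_ne (a c : R) {n i : ℕ} (h : i ≠ n) :
    basisShift a n (Finsupp.single i c) = Finsupp.single i c := by
  simp [basisShift, h]

/-- The composite of the first `n` basis shifts for the sequence `a`. -/
noncomputable def iterBasisShift (a : ℕ → R) : ℕ → (ℕ →₀ R) →ₗ[R] (ℕ →₀ R)
  | 0 => LinearMap.id
  | n + 1 => basisShift (a n) n ∘ₗ iterBasisShift a n

theorem iterBasisShift_succ (a : ℕ → R) (n : ℕ) (x : ℕ →₀ R) :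
    iterBasisShift a (n + 1) x = basisShift (a n) n (iterBasisShift a n x) := rfl

theorem iterBasisShift_of_le (a : ℕ → R) (c : R) {n i : ℕ} (h : n ≤ i) :
    iterBasisShift a n (Finsupp.single i c) = Finsupp.single i c := by
  induction n with
  | zero => rfl
  | succ n ih => rw [iterBasisShift_succ, ih (by omega), basisShift_of_ne _ _ (by omega)]

theorem exists_iterBasisShift_eq_single (a : ℕ → R) {n i : ℕ} (h : i ≤ n) :
    ∃ c, iterBasisShift a n (Finsupp.single i 1) = Finsupp.single n c := by
  induction n with
  | zero =>
    obtain rfl : i = 0 := by omega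
    exact ⟨1, rfl⟩
  | succ n ih =>
    rcases Nat.lt_or_ge n i with hi | hi
    · obtain rfl : i = n + 1 := by omega
      exact ⟨1, iterBasisShift_of_le a 1 le_rfl⟩
    · obtain ⟨c, hc⟩ := ih hi
      exact ⟨c * a n, by rw [iterBasisShift_succ, hc, basisShift_self]⟩

theorem iterBasisShift_idem (a : ℕ → R) (n : ℕ) (x : ℕ →₀ R) :
    iterBasisShift a n (iterBasisShift a n x) = iterBasisShift a n x := by
  rw [← LinearMap.comp_apply]
  congr 1
  ext i : 2
  simp only [LinearMap.comp_apply, Finsupp.lsingle_apply]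
  rcases le_total i n with hi | hi
  · obtain ⟨c, hc⟩ := exists_iterBasisShift_eq_single a hi
    rw [hc, iterBasisShift_of_le a c le_rfl]
  · rw [iterBasisShift_of_le a 1 hi, iterBasisShift_of_le a 1 hi]

theorem iterBasisShift_single_zero (a A : ℕ → R) (hA0 : A 0 = 1)
    (hA : ∀ n, A (n + 1) = A n * a n) (n : ℕ) :
    iterBasisShift a n (Finsupp.single 0 1) = Finsupp.single n (A n) := by
  induction n with
  | zero => rw [hA0]; rfl
  | succ n ih => rw [iterBasisShift_succ, ih, basisShift_self, hA]

/-- Bass: if flat modules are projective, then a descending chain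
`a₀R ⊇ a₀a₁R ⊇ a₀a₁a₂R ⊇ ⋯` terminates. -/
theorem exists_partialProd_eq_mul
    (hflat : ∀ F : ModuleCat.{u} R, IsFlatModule R F → Module.Projective R F)
    (a A : ℕ → R) (hA0 : A 0 = 1) (hA : ∀ n, A (n + 1) = A n * a n) :
    ∃ n r, A (n + 1) = A (n + 2) * r := by
  -- The quotient by the union of the `H n` is the direct limit of `R → R → ⋯` along right
  -- multiplication by `a 0`, `a 1`, …; each stage is projective because `iterBasisShift a n` is
  -- idempotent.
  let H : ℕ → Submodule R (ℕ →₀ R) := fun n => LinearMap.ker (iterBasisShift a n)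
  have hmono : Monotone H := monotone_nat_of_le_succ fun n x hx => by
    rw [LinearMap.mem_ker] at hx ⊢
    rw [iterBasisShift_succ, hx, map_zero]
  have hdir : Directed (· ≤ ·) H := hmono.directed_le
  have hpr : Module.Projective R ((ℕ →₀ R) ⧸ ⨆ n, H n) := by
    refine hflat (ModuleCat.of R _) (isFlatModule_quotient_iSup H hdir fun n => ?_)
    have := projective_quotient_ker_of_idempotent _ (iterBasisShift_idem a n)
    exact isFlatModule_of_projective _
  obtain ⟨s, hs⟩ := Module.projective_lifting_property (⨆ n, H n).mkQ LinearMap.id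
    (Submodule.mkQ_surjective _)
  have hs' : ∀ y, (⨆ n, H n).mkQ (s y) = y := fun y => LinearMap.congr_fun hs y
  let y : ℕ → (ℕ →₀ R) ⧸ ⨆ n, H n := fun n => (⨆ n, H n).mkQ (Finsupp.single n 1)
  have hy : ∀ n, y 0 = A n • y n := by
    intro n
    rw [← map_smul, ← sub_eq_zero, ← map_sub, Submodule.mkQ_apply, Submodule.Quotient.mk_eq_zero]
    refine Submodule.mem_iSup_of_mem n ?_
    rw [LinearMap.mem_ker, map_sub, iterBasisShift_single_zero a A hA0 hA, map_smul,
      iterBasisShift_of_le a 1 le_rfl]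
    simp
  -- At a stage `n` where this element dies, writing `y 0 = A (n + 2) • y (n + 2)` and comparing
  -- coefficients at `n` gives `A n = A (n + 2) * r'`. Right multiplication by `a n` gives the
  -- claim.
  have hmem : Finsupp.single 0 1 - s (y 0) ∈ ⨆ n, H n := by
    rw [← Submodule.Quotient.mk_eq_zero, ← Submodule.mkQ_apply, map_sub, hs', sub_self]
  obtain ⟨n, hn⟩ := (Submodule.mem_iSup_of_directed H hdir).1 hmem
  rw [LinearMap.mem_ker, map_sub, sub_eq_zero, iterBasisShift_single_zero a A hA0 hA,
    hy (n + 2), map_smul, map_smul] at hn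
  have h := DFunLike.congr_fun hn n
  rw [Finsupp.single_eq_same, Finsupp.smul_apply, smul_eq_mul] at h
  exact ⟨n, iterBasisShift a n (s (y (n + 2))) n * a n, by rw [hA, ← mul_assoc, ← h]⟩

theorem exists_mul_eq_one_sub_one_sub_pow (x : R) (n : ℕ) : ∃ t, 1 - (1 - x) ^ n = x * t := by
  induction n with
  | zero => exact ⟨0, by simp⟩
  | succ n ih =>
    obtain ⟨t, ht⟩ := ih
    refine ⟨1 + t * (1 - x), ?_⟩
    have : (1 - x) ^ n = 1 - x * t := by rw [← ht]; abel
    rw [pow_succ, this]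
    noncomm_ring

/-- The idempotent `ct` is carried to the other side as `t(ct)c`, a left multiple of `c`;
multiplying back by `c` and `t` recovers `ct`, so it is nonzero. -/
theorem exists_left_idempotent_of_right {c t : R} (h : IsIdempotentElem (c * t))
    (h0 : c * t ≠ 0) : ∃ r, IsIdempotentElem (r * c) ∧ r * c ≠ 0 := by
  have h' : c * (t * (c * t)) = c * t := by rw [← mul_assoc]; exact h
  refine ⟨t * (c * t), ?_, fun h1 => h0 ?_⟩
  · change t * (c * t) * c * (t * (c * t) * c) = t * (c * t) * c
    calc t * (c * t) * c * (t * (c * t) * c)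
        = t * ((c * t) * (c * t) * (c * t)) * c := by noncomm_ring
      _ = t * (c * t) * c := by rw [h, h]
  · calc c * t = (c * t) * (c * t) * (c * t) := by rw [h, h]
      _ = c * (t * (c * t) * c) * t := by noncomm_ring
      _ = 0 := by rw [h1]; simp

/-- If chains of principal right ideals terminate, then each element that is not nilpotent has a
nonzero idempotent left multiple. -/
theorem exists_idempotent_left_multiple
    (hflat : ∀ F : ModuleCat.{u} R, IsFlatModule R F → Module.Projective R F)
    (c : R) (hc : ¬ IsNilpotent c) : ∃ r, IsIdempotentElem (r * c) ∧ r * c ≠ 0 := by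
  -- `bR` is minimal among the `b'R` with `b'` a non-nilpotent right multiple of `b`; otherwise a
  -- strictly descending chain of principal right ideals starts at `cR`.
  obtain ⟨b, hb, ⟨u, rfl⟩, hmin⟩ : ∃ b, ¬ IsNilpotent b ∧ (∃ u, b = c * u) ∧
      ∀ t, ¬ IsNilpotent (b * t) → ∃ r, b = b * t * r := by
    by_contra! hcon
    let S := {b : R // ¬ IsNilpotent b ∧ ∃ u, b = c * u}
    have hstep : ∀ b : S, ∃ t, ¬ IsNilpotent (b.1 * t) ∧ ∀ r, b.1 ≠ b.1 * t * r := fun b =>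
      hcon b.1 b.2.1 b.2.2
    choose t ht ht' using hstep
    let next : S → S := fun b => ⟨b.1 * t b, ht b, by
      obtain ⟨u, hu⟩ := b.2.2
      exact ⟨u * t b, by rw [← mul_assoc, ← hu]⟩⟩
    let B : ℕ → S := fun n => next^[n] ⟨c, hc, 1, (mul_one c).symm⟩
    have hB : ∀ n, (B (n + 1)).1 = (B n).1 * t (B n) := fun n => by
      simp only [B, Function.iterate_succ_apply']
      rfl
    -- The shift `A (n + 1) = B n` makes room for `A 0 = 1`.
    let a : ℕ → R := fun n => Nat.casesOn n c fun k => t (B k)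
    let A : ℕ → R := fun n => Nat.casesOn n 1 fun k => (B k).1
    obtain ⟨n, r, hr⟩ := exists_partialProd_eq_mul hflat a A rfl (by
      rintro (_ | n)
      · exact (one_mul c).symm
      · exact hB n)
    refine ht' (B n) r ?_
    rw [← hB]
    exact hr
  set b := c * u with hbdef
  have hbb : ¬ IsNilpotent (b * b) := by
    rintro ⟨n, hn⟩
    exact hb ⟨2 * n, by rw [pow_mul, pow_two, hn]⟩
  obtain ⟨g, hg⟩ := hmin b hbb
  have hbe : b * (b * g) = b := by rw [← mul_assoc, ← hg]
  set e := b * g with hedef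
  -- Otherwise minimality puts `b` in `(e - e²)R`, which `b` kills on the left, so `b² = 0`.
  have hn : IsNilpotent (e - e ^ 2) := by
    have hform : e - e ^ 2 = b * (g - g * e) := by
      rw [pow_two, mul_sub, ← mul_assoc b g e]
    have hkill : b * (e - e ^ 2) = 0 := by
      rw [pow_two, mul_sub, ← mul_assoc b e e, hbe, hbe, sub_self]
    rw [hform]
    by_contra hnn
    obtain ⟨r, hr⟩ := hmin _ hnn
    refine hb ⟨2, ?_⟩
    rw [pow_two]
    nth_rw 2 [hr]
    rw [← hform, ← mul_assoc, hkill, zero_mul]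
  obtain ⟨k, hk⟩ := hn
  -- A positive exponent is needed: `e ^ (k + 1)` must have the left factor `c`, and `(1 - e ^ (k +
  -- 1)) ^ (k + 1)` must be killed by `b`. The latter shows that the lifted idempotent is nonzero.
  have hk1 : (e - e ^ 2) ^ (k + 1) = 0 := by rw [pow_succ, hk, zero_mul]
  have hid := isIdempotentElem_one_sub_one_sub_pow_pow e (k + 1) hk1
  obtain ⟨t, ht⟩ := exists_mul_eq_one_sub_one_sub_pow (e ^ (k + 1)) (k + 1)
  have hform : e ^ (k + 1) * t = c * (u * (g * e ^ k * t)) := by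
    rw [pow_succ', hedef, hbdef]; simp only [mul_assoc]
  rw [ht, hform] at hid
  refine exists_left_idempotent_of_right hid fun h0 => hb ?_
  rw [← hform, ← ht] at h0
  have hbpow : ∀ n, b * e ^ n = b := fun n => by
    induction n with
    | zero => simp
    | succ n ih => rw [pow_succ, ← mul_assoc, ih, hbe]
  have h1 : b * (1 - e ^ (k + 1)) = 0 := by rw [mul_sub, hbpow, mul_one, sub_self]
  have h2 : b * (1 - e ^ (k + 1)) ^ (k + 1) = 0 := by rw [pow_succ', ← mul_assoc, h1, zero_mul]
  rw [sub_eq_zero] at h0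
  rw [← h0, mul_one] at h2
  rw [h2]
  exact IsNilpotent.zero

/-- T-nilpotency: products of elements without nonzero idempotent left multiples vanish. -/
theorem exists_partialProd_eq_zero
    (hflat : ∀ F : ModuleCat.{u} R, IsFlatModule R F → Module.Projective R F)
    (a A : ℕ → R) (hA0 : A 0 = 1) (hA : ∀ n, A (n + 1) = A n * a n)
    (ha : ∀ n r, IsIdempotentElem (r * a n) → r * a n = 0) : ∃ n, A n = 0 := by
  obtain ⟨n, r, h⟩ := exists_partialProd_eq_mul hflat a A hA0 hA
  refine ⟨n + 1, ?_⟩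
  -- Otherwise some `s a(n+1) r` is a nonzero idempotent, and moving it to the left side contradicts
  -- `ha`. Nilpotency makes `1 - a(n+1) r` a unit, and this unit annihilates `A (n + 1)`.
  have hnil : IsNilpotent (a (n + 1) * r) := by
    by_contra hnn
    obtain ⟨s, hs, hs0⟩ := exists_idempotent_left_multiple hflat _ hnn
    have hcomm : s * (a (n + 1) * r) = (s * a (n + 1)) * r := (mul_assoc _ _ _).symm
    rw [hcomm] at hs hs0
    obtain ⟨t, ht, ht0⟩ := exists_left_idempotent_of_right hs hs0
    rw [← mul_assoc] at ht ht0
    exact ht0 (ha _ _ ht)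
  have h0 : A (n + 1) * (1 - a (n + 1) * r) = 0 := by
    rw [mul_sub, mul_one, ← mul_assoc, ← hA, ← h, sub_self]
  exact (hnil.isUnit_one_sub.mul_left_eq_zero).1 h0

/-- In a projective module, a submodule all of whose values under linear forms have no nonzero
idempotent left multiple is superfluous. -/
theorem eq_top_of_sup_eq_top
    (hflat : ∀ F : ModuleCat.{u} R, IsFlatModule R F → Module.Projective R F)
    {Q : Type u} [AddCommGroup Q] [Module R Q] [Module.Projective R Q] (K N : Submodule R Q)
    (hK : ∀ k ∈ K, ∀ (f : Q →ₗ[R] R) (r : R), IsIdempotentElem (r * f k) → r * f k = 0)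
    (hN : N ⊔ K = ⊤) : N = ⊤ := by
  obtain ⟨s, hs⟩ := Module.projective_def.1 (inferInstance : Module.Projective R Q)
  by_contra hne
  obtain ⟨p₀, hp₀⟩ : ∃ p, p ∉ N := by
    by_contra! h
    exact hne (eq_top_iff.2 fun p _ => h p)
  let J : Set R := {c | ∀ r, IsIdempotentElem (r * c) → r * c = 0}
  let S := {x : R × Q // x.1 • x.2 ∉ N}
  -- Modulo `N`, `p` may be replaced by an element of `K`, whose dual basis coordinates lie in `J`;
  -- one of them must keep the product outside `N`. Iterating gives products that never vanish,
  -- against T-nilpotency.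
  have hstep : ∀ x : S, ∃ c ∈ J, ∃ q : Q, (x.1.1 * c) • q ∉ N := by
    rintro ⟨⟨a, p⟩, hap⟩
    by_contra! hcon
    refine hap ?_
    obtain ⟨n, hn, k, hk, rfl⟩ := Submodule.mem_sup.1 (hN ▸ Submodule.mem_top : p ∈ N ⊔ K)
    rw [smul_add]
    refine N.add_mem (N.smul_mem _ hn) ?_
    rw [← hs k, Finsupp.linearCombination_apply, Finsupp.sum, Finset.smul_sum]
    refine N.sum_mem fun q _ => ?_
    rw [← mul_smul]
    exact hcon _ (hK k hk (Finsupp.lapply q ∘ₗ s)) q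
  choose c hc q hq using hstep
  let next : S → S := fun x => ⟨(x.1.1 * c x, q x), hq x⟩
  let B : ℕ → S := fun n => next^[n] ⟨(1, p₀), by simpa using hp₀⟩
  obtain ⟨n, hn⟩ := exists_partialProd_eq_zero hflat (fun n => c (B n)) (fun n => (B n).1.1) rfl
    (fun n => by simp only [B, Function.iterate_succ_apply']; rfl) (fun n => hc (B n))
  refine (B n).2 ?_
  rw [hn, zero_smul]
  exact N.zero_mem

/-- If flat modules are projective, then every module has a projective cover. -/
theorem isLeftPerfectRing_of_flat_projective
    (hflat : ∀ F : ModuleCat.{u} R, IsFlatModule R F → Module.Projective R F) :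
    IsLeftPerfectRing R := by
  intro M
  let π : (M →₀ R) →ₗ[R] M := Finsupp.linearCombination R id
  have hπ : Function.Surjective π := fun m => ⟨Finsupp.single m 1, by simp [π]⟩
  -- The cover is the quotient by a maximal such `U`: as much of the kernel as possible is removed
  -- while the quotient stays projective. Unions of chains qualify because their quotients are flat.
  let S : Set (Submodule R (M →₀ R)) :=
    {U | U ≤ LinearMap.ker π ∧ Module.Projective R ((M →₀ R) ⧸ U)}
  obtain ⟨U, -, ⟨hUK, hU⟩, hmax⟩ := zorn_le_nonempty₀ S (by
    intro C hCS hC V hV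
    have : Nonempty C := ⟨⟨V, hV⟩⟩
    refine ⟨⨆ i : C, i.1, ⟨iSup_le fun i => (hCS i.2).1, ?_⟩, fun W hW =>
      le_iSup (fun i : C => i.1) ⟨W, hW⟩⟩
    refine hflat (ModuleCat.of R _) (isFlatModule_quotient_iSup _ hC.directed fun i => ?_)
    have := (hCS i.2).2
    exact isFlatModule_of_projective _) ⊥ ⟨bot_le,
      Module.Projective.of_equiv' (Submodule.quotEquivOfEqBot ⊥ rfl).symm⟩
  refine ⟨ModuleCat.of R ((M →₀ R) ⧸ U), U.liftQ π hUK, hU, ?_, ?_⟩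
  · intro m
    obtain ⟨p, rfl⟩ := hπ m
    exact ⟨U.mkQ p, U.liftQ_apply π p⟩
  · intro N hN
    refine eq_top_of_sup_eq_top hflat _ N ?_ hN
    intro k hk f r hr
    set e := r * f k with he
    -- Chosen so that `f x = e` and `e • x = x`: then `ψ` is an idempotent killing `x ∈ ker`, and
    -- dividing by `ker ψ` would enlarge `U` unless `x = 0`.
    let x := (e * r) • k
    have hfx : f x = e := by
      rw [map_smul, smul_eq_mul, mul_assoc, ← he, hr]
    have hex : e • x = x := by rw [← mul_smul, ← mul_assoc, hr]
    let ψ : ((M →₀ R) ⧸ U) →ₗ[R] ((M →₀ R) ⧸ U) := LinearMap.id - f.smulRight x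
    have hψ : ∀ p, ψ p = p - f p • x := fun p => rfl
    have hψx : ψ x = 0 := by rw [hψ, hfx, hex, sub_self]
    have hidem : ∀ p, ψ (ψ p) = ψ p := by
      intro p
      rw [hψ p, map_sub, map_smul, hψx, smul_zero, sub_zero, hψ]
    have hproj := projective_quotient_ker_of_idempotent ψ hidem
    let g := (LinearMap.ker ψ).mkQ ∘ₗ U.mkQ
    have hg : Function.Surjective g :=
      (Submodule.mkQ_surjective _).comp (Submodule.mkQ_surjective _)
    have hmem : LinearMap.ker g ∈ S := by
      refine ⟨fun p hp => ?_, Module.Projective.of_equiv' (g.quotKerEquivOfSurjective hg).symm⟩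
      have hp' : ψ (U.mkQ p) = 0 := (Submodule.Quotient.mk_eq_zero _).1 hp
      rw [hψ, sub_eq_zero] at hp'
      have : U.liftQ π hUK (U.mkQ p) = 0 := by
        rw [hp', map_smul, map_smul, LinearMap.mem_ker.1 hk, smul_zero, smul_zero]
      exact this
    obtain ⟨p, hp⟩ := U.mkQ_surjective x
    have hpU : p ∈ U := by
      refine hmax hmem (fun v hv => ?_) ?_
      · have : U.mkQ v = 0 := (Submodule.Quotient.mk_eq_zero _).2 hv
        rw [LinearMap.mem_ker, LinearMap.comp_apply, this, map_zero]
      · rw [LinearMap.mem_ker, LinearMap.comp_apply, hp]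
        exact (Submodule.Quotient.mk_eq_zero _).2 hψx
    have hx0 : x = 0 := hp ▸ (Submodule.Quotient.mk_eq_zero _).2 hpU
    rw [← hfx, hx0, map_zero]

end Perfect

/-! ### Ding projective covers -/

section DingProjective

variable {R : Type u} [Ring R]

/-- The complex with terms `P × P` and differential `(x, y) ↦ (y, 0)` is contractible, so it stays
exact under every `Hom(-, F)`. -/
theorem isDingProjective_of_projective (P : ModuleCat.{u} R) [Module.Projective R P] :
    IsDingProjective R P := by
  let d : (P × P) →ₗ[R] (P × P) := LinearMap.inl R P P ∘ₗ LinearMap.snd R P P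
  have hd : ∀ x, d x = (x.2, 0) := fun _ => rfl
  refine ⟨fun _ => ModuleCat.of R (P × P), fun _ => d,
    fun _ => inferInstanceAs (Module.Projective R (P × P)), fun _ => ?_, fun F _ _ => ?_, 0, ⟨?_⟩⟩
  · rintro ⟨x, y⟩
    constructor
    · intro h
      obtain rfl : y = 0 := (Prod.ext_iff.1 h).1
      exact ⟨(0, x), rfl⟩
    · rintro ⟨z, h⟩
      obtain rfl : (0 : P) = y := (Prod.ext_iff.1 h).2
      rfl
  · intro g
    constructor
    · intro h
      refine ⟨g ∘ₗ LinearMap.inr R P P ∘ₗ LinearMap.fst R P P, ?_⟩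
      refine LinearMap.ext fun x => ?_
      have h1 : g (x.1, 0) = 0 := LinearMap.congr_fun h (0, x.1)
      have h2 : g x = g (x.1, 0) + g (0, x.2) := by
        rw [← map_add]; simp
      rw [h2, h1, zero_add]
      rfl
    · rintro ⟨h, rfl⟩
      refine LinearMap.ext fun x => ?_
      exact map_zero h
  · refine LinearEquiv.ofBijective
      ((LinearMap.inl R P P).codRestrict (LinearMap.ker d) fun x => rfl) ⟨fun x y h => ?_, ?_⟩
    · exact (Prod.ext_iff.1 (Subtype.ext_iff.1 h)).1
    · rintro ⟨⟨x, y⟩, h⟩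
      obtain rfl : y = 0 := (Prod.ext_iff.1 h).1
      exact ⟨x, rfl⟩

/-- The linear maps from `D` to `M` extend along some embedding of `D` into a projective module. -/
def ExtendsToProjective (D M : ModuleCat.{u} R) : Prop :=
  ∃ (P : ModuleCat.{u} R) (ι : D →ₗ[R] P), Module.Projective R P ∧
    ∀ g : D →ₗ[R] M, ∃ h : P →ₗ[R] M, h ∘ₗ ι = g

/-- If maps from the source of a Ding projective cover extend to a projective module, then the cover
is a projective cover. -/
theorem IsClassCover.hasProjectiveCover {D M : ModuleCat.{u} R} {f : D ⟶ M}
    (hf : IsClassCover (IsDingProjective R) f) (hext : ExtendsToProjective D M) :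
    HasProjectiveCover R M := by
  have hsurj : Function.Surjective f.hom := by
    intro m
    obtain ⟨h, hh⟩ := hf.factors (ModuleCat.of R R)
      (@isDingProjective_of_projective _ _ (ModuleCat.of R R)
        (inferInstanceAs (Module.Projective R R)))
      (ModuleCat.ofHom (LinearMap.toSpanSingleton R M m))
    refine ⟨h.hom (1 : R), ?_⟩
    rw [← LinearMap.comp_apply, ← ModuleCat.hom_comp, hh]
    exact one_smul R m
  have hbij : ∀ u : D →ₗ[R] D, f.hom ∘ₗ u = f.hom → Function.Bijective u := by
    intro u hu
    have := hf.isIso (ModuleCat.ofHom u) (ModuleCat.hom_ext hu)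
    exact (ConcreteCategory.isIso_iff_bijective (ModuleCat.ofHom u)).1 this
  obtain ⟨P, ι, hP, hι⟩ := hext
  obtain ⟨g, hg⟩ := hι f.hom
  obtain ⟨h, hh⟩ := Module.projective_lifting_property f.hom g hsurj
  have hD : Module.Projective R D := by
    let e := LinearEquiv.ofBijective (h ∘ₗ ι)
      (hbij (h ∘ₗ ι) (by rw [← LinearMap.comp_assoc, hh, hg]))
    refine Module.Projective.of_split ι (e.symm.toLinearMap ∘ₗ h) ?_
    ext x
    exact e.symm_apply_apply x
  refine ⟨D, f.hom, hD, hsurj, fun N hN => ?_⟩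
  have hNsurj : Function.Surjective (f.hom ∘ₗ N.subtype) := by
    intro m
    obtain ⟨p, rfl⟩ := hsurj m
    obtain ⟨n, hn, k, hk, rfl⟩ :=
      Submodule.mem_sup.1 (hN ▸ Submodule.mem_top : p ∈ N ⊔ LinearMap.ker f.hom)
    exact ⟨⟨n, hn⟩, by rw [map_add, LinearMap.mem_ker.1 hk, add_zero]; rfl⟩
  -- Lifting `f` through `N` gives an endomorphism over `M` with image in `N`; it is an
  -- automorphism, so `N` is everything.
  obtain ⟨v, hv⟩ := Module.projective_lifting_property (f.hom ∘ₗ N.subtype) f.hom hNsurj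
  refine eq_top_iff.2 fun p _ => ?_
  obtain ⟨x, rfl⟩ := (hbij (N.subtype ∘ₗ v) hv).2 p
  exact (v x).2

theorem extendsToProjective_of_linearEquiv {D D' M : ModuleCat.{u} R} (e : D ≃ₗ[R] D')
    (h : ExtendsToProjective D' M) : ExtendsToProjective D M := by
  obtain ⟨P, ι, hP, hι⟩ := h
  refine ⟨P, ι ∘ₗ e.toLinearMap, hP, fun g => ?_⟩
  obtain ⟨h, hh⟩ := hι (g ∘ₗ e.symm.toLinearMap)
  refine ⟨h, ?_⟩
  rw [← LinearMap.comp_assoc, hh]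
  ext x
  simp

/-- The cycles in `P (i + 1)` are the image of `d (i + 1)`. A map from them to `F` pulls back to a
cocycle on `P (i + 2)`, and exactness of `Hom(-, F)` makes it come from `P (i + 1)`. -/
theorem extendsToProjective_of_isFlatModule {D F : ModuleCat.{u} R} (hD : IsDingProjective R D)
    (hF : IsFlatModule R F) : ExtendsToProjective D F := by
  obtain ⟨P, d, hP, hex, hflat, i, ⟨e⟩⟩ := hD
  refine extendsToProjective_of_linearEquiv (D' := ModuleCat.of R (LinearMap.ker (d i))) e
    ⟨P (i + 1), (LinearMap.ker (d i)).subtype, hP _, fun g => ?_⟩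
  have hker : ∀ x, d (i + 1) x ∈ LinearMap.ker (d i) := fun x => (hex i _).2 ⟨x, rfl⟩
  let g' : P (i + 1 + 1) →ₗ[R] F := g ∘ₗ (d (i + 1)).codRestrict (LinearMap.ker (d i)) hker
  obtain ⟨h, hh⟩ := (hflat F hF (i + 1) g').1 (by
    refine LinearMap.ext fun x => ?_
    have : (d (i + 1)).codRestrict (LinearMap.ker (d i)) hker (d (i + 1 + 1) x) = 0 :=
      Subtype.ext ((hex (i + 1) _).2 ⟨x, rfl⟩)
    change g ((d (i + 1)).codRestrict (LinearMap.ker (d i)) hker (d (i + 1 + 1) x)) = 0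
    rw [this, map_zero])
  refine ⟨h, LinearMap.ext fun ⟨x, hx⟩ => ?_⟩
  obtain ⟨y, rfl⟩ := (hex i x).1 hx
  exact LinearMap.congr_fun hh y

/-- The cokernel of the inclusion of the cycles is the next module of cycles `ker (d j)`, Ding
projective through the same complex. The obstruction to extending lies in its `Ext¹` into `M`, which
vanishes. -/
theorem extendsToProjective_of_extRightOrthogonal {D M : ModuleCat.{u} R}
    (hD : IsDingProjective R D) (hM : extRightOrthogonal (IsDingProjective R) M) :
    ExtendsToProjective D M := by
  obtain ⟨P, d, hP, hex, hflat, i, ⟨e⟩⟩ := hD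
  obtain ⟨j, rfl⟩ : ∃ j, i = j + 1 := ⟨i - 1, by ring⟩
  have hker : ∀ x, d (j + 1) x ∈ LinearMap.ker (d j) := fun x => (hex j _).2 ⟨x, rfl⟩
  let q := (d (j + 1)).codRestrict (LinearMap.ker (d j)) hker
  let S : ShortComplex (ModuleCat.{u} R) :=
    ShortComplex.mk (X₁ := ModuleCat.of R (LinearMap.ker (d (j + 1)))) (X₂ := P (j + 1 + 1))
      (X₃ := ModuleCat.of R (LinearMap.ker (d j)))
      (ModuleCat.ofHom (LinearMap.ker (d (j + 1))).subtype) (ModuleCat.ofHom q) (by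
        ext x
        exact x.2)
  have hS : S.ShortExact :=
    { exact := by
        rw [ShortComplex.ShortExact.moduleCat_exact_iff_function_exact]
        intro x
        constructor
        · intro hx
          exact ⟨⟨x, congrArg Subtype.val hx⟩, rfl⟩
        · rintro ⟨y, rfl⟩
          exact Subtype.ext y.2
      mono_f := (ModuleCat.mono_iff_injective _).2 Subtype.val_injective
      epi_g := (ModuleCat.epi_iff_surjective _).2 (by
        rintro ⟨x, hx⟩
        obtain ⟨y, rfl⟩ := (hex j x).1 hx
        exact ⟨y, rfl⟩) }
  have hsub : Subsingleton (Abelian.Ext.{u} S.X₃ M 1) :=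
    hM _ ⟨P, d, hP, hex, hflat, j, ⟨LinearEquiv.refl R _⟩⟩
  refine extendsToProjective_of_linearEquiv (D' := S.X₁) e
    ⟨S.X₂, S.f.hom, hP _, fun g => ?_⟩
  obtain ⟨x, hx⟩ := Abelian.Ext.contravariant_sequence_exact₁ hS M
    (Abelian.Ext.mk₀ (ModuleCat.ofHom g)) (add_zero 1) (Subsingleton.elim _ _)
  obtain ⟨h, rfl⟩ := (Abelian.Ext.mk₀_bijective _ _).2 x
  rw [Abelian.Ext.mk₀_comp_mk₀] at hx
  have := (Abelian.Ext.mk₀_bijective _ _).1 hx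
  exact ⟨h.hom, congrArg ModuleCat.Hom.hom this⟩

end DingProjective

/-! ### The main theorem -/

theorem proposition11 (R : Type u) [Ring R] (hcov : IsCoveringClass (IsDingProjective R)) :
    (∀ M : ModuleCat.{u} R, extRightOrthogonal (IsDingProjective R) M → HasProjectiveCover R M) ∧
    (∀ F : ModuleCat.{u} R, IsFlatModule R F → Module.Projective R F) ∧
    IsLeftPerfectRing R := by
  have hflat : ∀ F : ModuleCat.{u} R, IsFlatModule R F → Module.Projective R F := by
    intro F hF
    obtain ⟨D, f, hf⟩ := hcov F
    exact hF.projective_of_hasProjectiveCover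
      (hf.hasProjectiveCover (extendsToProjective_of_isFlatModule hf.mem hF))
  refine ⟨fun M hM => ?_, hflat, isLeftPerfectRing_of_flat_projective hflat⟩
  obtain ⟨D, f, hf⟩ := hcov M
  exact hf.hasProjectiveCover (extendsToProjective_of_extRightOrthogonal hf.mem hM)
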